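/- Consider the rule 54 reversible cellular automaton on $\{0,1\}^{\mathbb Z}$: with $\chi(a,b,c)=a+b+c+ac \pmod 2$, set $s_x^{t+1}=\chi(s_{x-1}^t,s_x^t,s_{x+1}^t)$ if $x+t$ is even and $s_x^{t+1}=s_x^t$ if $x+t$ is odd. For an observable $a$ put $a^t(s^0)=a(s^t)$, and let $[1]_x(s)=1$ if $s_x=1$ and $0$ otherwise. Let $\langle\cdot\rangle$ be the expectation in the maximum entropy state, in which the $s_x$ are independent and each equals $0$ or $1$ with probability $1/2$. The dynamic structure factor is $$C(x,t)=\langle [1]_x\,[1]_0^t\rangle-\langle[1]_x\rangle\langle[1]_0^t\rangle ,\qquad \Delta C(x,t)=2^{2t+1}\bigl(C(x+2,t)-C(x,t)\bigr).$$ Convention: $\binom nk=0$ unless $0\le k\le n$; empty sums are $0$. Let $t\ge 1$ and $x$ be integers with $x+t$ even. Then the following hold. 1. Unless $t=2$ and $x\in\{-2,0\}$, $$\Delta C(x,t)=\begin{cases}2^{2t+x}\left(\binom{-x-3}{(x+t)/2}-\binom{-x-3}{(x+t-2)/2}\right),& x\le-3,\\[2pt] 0,&-2\le x\le 0,\\[2pt]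 -2^{2t-x-2}\left(\binom{x-1}{(t-x-2)/2}-\binom{x-1}{(t-x-4)/2}\right),& x\ge 1.\end{cases}$$ 2. $C(-t,t)=0$ and $$C(x,t)=C(-t,t)+2^{-2t-1}\sum_{m=0}^{(t-|x|-2)/2}\Delta C(-t+2m,t)=2^{-t-1}\sum_{m=0}^{(t-|x|-2)/2}4^m\left(2\binom{t-2m-3}{m}-\binom{t-2m-2}{m}\right).$$ 3. $C(x,t)$ is unchanged if $[1]_0^t$ is instead defined by the recursion $a^{t+1}=U(t)a^t$, $a^0=a$, where $(U(t)a)(s)=a(M_t s)$ and $M_t$ is the one-step map taking the configuration at time $t$ to that at time $t+1$. -/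

import Mathlib

open MeasureTheory

noncomputable section

namespace RCA54

/-- Configurations of the chain: site `x` is empty if `s x = 0` and occupied if `s x = 1`. -/
abbrev Config : Type := ℤ → Fin 2

/-- The local rule (arithmetic in `Fin 2` is arithmetic modulo 2). -/
def chi (s₁ s₂ s₃ : Fin 2) : Fin 2 := s₁ + s₂ + s₃ + s₁ * s₃

/-- Update of all even sites. -/
def evenUpdate (s : Config) : Config := fun x =>
  if Even x then chi (s (x - 1)) (s x) (s (x + 1)) else s x

/-- Update of all odd sites. -/
def oddUpdate (s : Config) : Config := fun x =>
  if Even x then s x else chi (s (x - 1)) (s x) (s (x + 1))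

/-- The map taking the configuration at time `t` to the configuration at time `t + 1`. -/
def step (t : ℕ) : Config → Config := if Even t then evenUpdate else oddUpdate

/-- The configuration at time `t` started from `s` at time `0`. -/
def flow (s : Config) : ℕ → Config
  | 0 => s
  | t + 1 => step t (flow s t)

/-- Real observables. -/
abbrev Observable : Type := Config → ℝ

/-- The one-site observable `[α]_x`, with value `1` if `s x = α` and `0` otherwise. -/
def siteObs (α : Fin 2) (x : ℤ) : Observable := fun s => if s x = α then 1 else 0

/-- The time-evolved observable, `a^t (s^0) = a (s^t)`. -/
def evolve (t : ℕ) (a : Observable) : Observable := fun s => a (flow s t)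

/-- The automorphism `U(t)` of the algebra of observables, the composition with the one-step map. -/
def autU (t : ℕ) (a : Observable) : Observable := fun s => a (step t s)

/-- The evolution of observables by the recursion `a^(t+1) = U(t) a^t`. The maps `U(t)` are
applied here in the opposite order to `evolve`. -/
def evolveRec : ℕ → Observable → Observable
  | 0, a => a
  | t + 1, a => autU t (evolveRec t a)

/-- The separable state: the `s x` are independent with laws `p x`. -/
def separableState (p : ℤ → PMF (Fin 2)) : Measure Config :=
  Measure.infinitePi fun x => (p x).toMeasure

/-- The maximum entropy state, in which each site is empty or occupied with probability `1/2`. -/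
def maxEntropyState : Measure Config := separableState fun _ => PMF.uniformOfFintype (Fin 2)

/-- Expectation value in the maximum entropy state. -/
def expect (a : Observable) : ℝ := ∫ s, a s ∂maxEntropyState

/-- The covariance of `[1]_x` and `b` in the maximum entropy state. -/
def densityCov (x : ℤ) (b : Observable) : ℝ :=
  expect (fun s => siteObs 1 x s * b s) - expect (siteObs 1 x) * expect b

/-- The dynamic structure factor `C(x,t)`. -/
def structureFactor (x : ℤ) (t : ℕ) : ℝ := densityCov x (evolve t (siteObs 1 0))

/-- The dynamic structure factor for the evolution `a^(t+1) = U(t) a^t`. -/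
def structureFactorRec (x : ℤ) (t : ℕ) : ℝ := densityCov x (evolveRec t (siteObs 1 0))

/-- The scaled difference `ΔC(x,t) = 2^(2t+1) (C(x+2,t) - C(x,t))`. -/
def scaledDiff (x : ℤ) (t : ℕ) : ℝ :=
  2 ^ (2 * t + 1) * (structureFactor (x + 2) t - structureFactor x t)

/-- Binomial coefficient of integers, zero unless `0 ≤ k ≤ n`. -/
def binom (n k : ℤ) : ℝ := if 0 ≤ n ∧ 0 ≤ k then (n.toNat.choose k.toNat : ℝ) else 0

end RCA54

end

noncomputable section

namespace RCA54

/-! In spin variables the rule multiplies a site by `-1` unless both neighbours are empty, and the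
covariance of two densities is a quarter of the correlation of two spins. Every step is an
involution preserving the maximum entropy state, so in `corr` a step can be moved from the evolved
spin onto the other factor (`corr_succ`): one studies how `spin x` spreads towards the origin.

The core is a family of densities with a free spin on the left whose correlation with the origin
spin vanishes at all times (`corr_left_spin`). The family is closed under the dynamics, and at time
`0` the free spin is independent of everything else. Modulo these null densities, the difference
`D(x,t)` of correlations at `x+2` and `x` satisfies `D(x,t) = (D(x+1,t-1) + D(x+1,t-3))/2` left of
the origin (`corr_spin_sub_recursion`): a move takes one step, or three when delayed.

Reflection symmetry gives `D(-1,t) = 0`, which with a few small times fixes the boundary values.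
Pascal's rule then solves the recursion (`corrDiff_eq`), and reflection gives the other side.
Summing the differences from the edge of the light cone, where the correlation vanishes, gives
`C(x,t)`. The two orders of evolution agree because alternating products of two maps of odd length
are palindromes, while for even length the extra step leaves both relevant sites fixed. -/

/-! ### Spins and the one-step maps. -/

/-- The spin `+1` of an empty site and `-1` of an occupied site. -/
def spin (x : ℤ) : Observable := fun s => if s x = 0 then 1 else -1

/-- The sign by which a site is multiplied under the local rule, in terms of its two
neighbouring spins. -/
def flipSign (a b : ℝ) : ℝ := (a + b + a * b - 1) / 2

lemma spin_eq_or (x : ℤ) (s : Config) : spin x s = 1 ∨ spin x s = -1 := by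
  unfold spin; split_ifs <;> simp

lemma spin_chi (a b c : Fin 2) :
    (if chi a b c = 0 then (1 : ℝ) else -1) =
      (if b = 0 then 1 else -1) * flipSign (if a = 0 then 1 else -1) (if c = 0 then 1 else -1) := by
  fin_cases a <;> fin_cases b <;> fin_cases c <;> simp [chi, flipSign] <;> norm_num

lemma step_apply (n : ℕ) (s : Config) (x : ℤ) :
    step n s x = if Even (x + n) then chi (s (x - 1)) (s x) (s (x + 1)) else s x := by
  unfold step
  by_cases hn : Even n
  · have : Even (x + n) ↔ Even x := by
      rw [Int.even_add]; simp [hn]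
    simp only [hn, if_true, evenUpdate, this]
  · have : Even (x + n) ↔ ¬ Even x := by
      rw [Int.even_add]; simp [hn]
    simp only [hn, if_false, oddUpdate, this]
    split_ifs <;> rfl

lemma spin_step_of_even {n : ℕ} {x : ℤ} (h : Even (x + n)) (s : Config) :
    spin x (step n s) = spin x s * flipSign (spin (x - 1) s) (spin (x + 1) s) := by
  simp only [spin, step_apply, h, if_true, spin_chi]

lemma spin_step_of_odd {n : ℕ} {x : ℤ} (h : ¬ Even (x + n)) (s : Config) :
    spin x (step n s) = spin x s := by
  simp only [spin, step_apply, h, if_false]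

lemma chi_chi (a b c : Fin 2) : chi a (chi a b c) c = b := by
  revert a b c; decide

/-- The neighbours of an updated site are frozen during the step, and `chi` is an involution in its
middle argument. -/
lemma step_step (n : ℕ) (s : Config) : step n (step n s) = s := by
  funext x
  rw [step_apply]
  by_cases h : Even (x + n)
  · have h1 : ¬ Even (x - 1 + n) := by
      rw [show x - 1 + (n : ℤ) = x + n - 1 by ring, Int.even_sub_one]; simpa using h
    have h2 : ¬ Even (x + 1 + n) := by
      rw [show x + 1 + (n : ℤ) = x + n + 1 by ring, Int.even_add_one]; simpa using h
    simp only [h, if_true, step_apply, h1, h2, if_false, chi_chi]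
  · simp only [step_apply, h, if_false]

/-! ### Local observables and their expectations. -/

/-- Observables that depend on finitely many sites. -/
def IsLocal (f : Observable) : Prop := ∃ N : ℕ, DependsOn f {i : ℤ | |i| ≤ N}

lemma IsLocal.of_two {f g h : Observable} (hf : IsLocal f) (hg : IsLocal g)
    (H : ∀ s s', f s = f s' → g s = g s' → h s = h s') : IsLocal h := by
  obtain ⟨N, hN⟩ := hf
  obtain ⟨M, hM⟩ := hg
  refine ⟨max N M, fun s s' hs => H s s' (hN fun i hi => hs i ?_) (hM fun i hi => hs i ?_)⟩
  · exact le_trans (b := (N : ℤ)) hi (by exact_mod_cast le_max_left N M)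
  · exact le_trans (b := (M : ℤ)) hi (by exact_mod_cast le_max_right N M)

lemma IsLocal.add {f g : Observable} (hf : IsLocal f) (hg : IsLocal g) :
    IsLocal (fun s => f s + g s) := hf.of_two hg fun s s' h1 h2 => by rw [h1, h2]

lemma IsLocal.sub {f g : Observable} (hf : IsLocal f) (hg : IsLocal g) :
    IsLocal (fun s => f s - g s) := hf.of_two hg fun s s' h1 h2 => by rw [h1, h2]

lemma IsLocal.mul {f g : Observable} (hf : IsLocal f) (hg : IsLocal g) :
    IsLocal (fun s => f s * g s) := hf.of_two hg fun s s' h1 h2 => by rw [h1, h2]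

lemma IsLocal.map {f : Observable} (hf : IsLocal f) (F : ℝ → ℝ) : IsLocal (fun s => F (f s)) :=
  hf.of_two hf fun s s' h1 _ => by rw [h1]

lemma IsLocal.const (c : ℝ) : IsLocal (fun _ => c) := ⟨0, fun _ _ _ => rfl⟩

lemma IsLocal.spin (x : ℤ) : IsLocal (spin x) := by
  refine ⟨x.natAbs, fun s s' h => ?_⟩
  have := h x (by simp)
  simp [RCA54.spin, this]

lemma IsLocal.flipSign {f g : Observable} (hf : IsLocal f) (hg : IsLocal g) :
    IsLocal (fun s => flipSign (f s) (g s)) := hf.of_two hg fun s s' h1 h2 => by rw [h1, h2]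

lemma IsLocal.comp_step {f : Observable} (hf : IsLocal f) (n : ℕ) :
    IsLocal (fun s => f (step n s)) := by
  obtain ⟨N, hN⟩ := hf
  refine ⟨N + 1, fun s s' hs => hN fun i hi => ?_⟩
  have hi' : |i| ≤ (N : ℤ) := hi
  rw [abs_le] at hi'
  have key : ∀ j : ℤ, -(N + 1 : ℤ) ≤ j → j ≤ N + 1 → s j = s' j := fun j h1 h2 =>
    hs j (by simp only [Set.mem_ofPred_eq, abs_le]; push_cast; omega)
  rw [step_apply, step_apply, key (i - 1) (by omega) (by omega), key i (by omega) (by omega),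
    key (i + 1) (by omega) (by omega)]

lemma IsLocal.comp_update {f : Observable} (hf : IsLocal f) (x : ℤ) (a : Fin 2) :
    IsLocal (fun s => f (Function.update s x a)) := by
  obtain ⟨N, hN⟩ := hf
  refine ⟨N, fun s s' hs => hN fun i hi => ?_⟩
  simp only [Function.update_apply]
  split_ifs
  · rfl
  · exact hs i hi

instance : IsProbabilityMeasure maxEntropyState := by
  unfold maxEntropyState separableState; infer_instance

lemma IsLocal.integrable {f : Observable} (hf : IsLocal f) : Integrable f maxEntropyState := by
  obtain ⟨N, hN⟩ := hf
  obtain ⟨g, rfl⟩ := dependsOn_iff_exists_comp.1 hN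
  have hfin : Finite {i : ℤ | |i| ≤ N} := by
    refine Set.Finite.subset (Set.finite_Icc (-(N : ℤ)) N) fun i hi => ?_
    simpa [abs_le] using hi
  have hm : Measurable g := measurable_of_finite g
  obtain ⟨C, hC⟩ : ∃ C, ∀ y, ‖g y‖ ≤ C := by
    obtain ⟨C, hC⟩ := (Set.finite_range fun y => ‖g y‖).bddAbove
    exact ⟨C, fun y => hC ⟨y, rfl⟩⟩
  refine Integrable.of_bound (C := C) ?_ (Filter.Eventually.of_forall fun s => hC _)
  exact (hm.comp (by unfold Set.domRestrict; fun_prop)).aestronglyMeasurable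

lemma expect_add {f g : Observable} (hf : IsLocal f) (hg : IsLocal g) :
    expect (fun s => f s + g s) = expect f + expect g := integral_add hf.integrable hg.integrable

lemma expect_sub {f g : Observable} (hf : IsLocal f) (hg : IsLocal g) :
    expect (fun s => f s - g s) = expect f - expect g := integral_sub hf.integrable hg.integrable

lemma expect_const_mul (c : ℝ) (f : Observable) :
    expect (fun s => c * f s) = c * expect f := integral_const_mul c f

lemma expect_const (c : ℝ) : expect (fun _ => c) = c := by simp [expect]

/-! ### Invariance of the maximum entropy state under flips, steps and reflection. -/

/-- The configuration with site `x` flipped. -/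
def flip (x : ℤ) (s : Config) : Config := Function.update s x (s x + 1)

lemma map_uniform_of_involutive (e : Fin 2 → Fin 2) (he : Function.Involutive e) :
    (PMF.uniformOfFintype (Fin 2)).toMeasure.map e = (PMF.uniformOfFintype (Fin 2)).toMeasure := by
  refine Measure.ext_of_singleton fun a => ?_
  rw [Measure.map_apply (measurable_of_finite e) (measurableSet_singleton a)]
  have : e ⁻¹' {a} = {e a} := by
    ext b
    simp only [Set.mem_preimage, Set.mem_singleton_iff]
    exact ⟨fun h => by rw [← h, he], fun h => by rw [h, he]⟩
  rw [this, PMF.toMeasure_apply_singleton _ _ (measurableSet_singleton _),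
    PMF.toMeasure_apply_singleton _ _ (measurableSet_singleton _)]
  simp

lemma expect_comp_flip {f : Observable} (hf : IsLocal f) (x : ℤ) :
    expect (fun s => f (flip x s)) = expect f := by
  let e : ℤ → Fin 2 → Fin 2 := fun i a => if i = x then a + 1 else a
  have hflip : flip x = fun s i => e i (s i) := by
    funext s i
    by_cases h : i = x
    · subst h; simp [flip, e]
    · simp [flip, e, h]
  have hmap : maxEntropyState.map (flip x) = maxEntropyState := by
    rw [hflip]
    unfold maxEntropyState separableState
    rw [Measure.infinitePi_map_pi _ (fun i => measurable_of_finite (e i))]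
    congr 1
    funext i
    refine map_uniform_of_involutive _ fun a => ?_
    by_cases h : i = x
    · simp only [e, h, if_true]; revert a; decide
    · simp [e, h]
  have hmeas : Measurable (flip x) := by
    rw [hflip]
    exact measurable_pi_lambda _ fun i => (measurable_of_finite (e i)).comp (measurable_pi_apply i)
  unfold expect
  conv_rhs => rw [← hmap]
  rw [integral_map hmeas.aemeasurable]
  rw [hmap]; exact hf.integrable.aestronglyMeasurable

lemma spin_flip_self (x : ℤ) (s : Config) : spin x (flip x s) = -spin x s := by
  have : ∀ a : Fin 2, a = 0 ∨ a = 1 := by decide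
  rcases this (s x) with h | h <;> simp [spin, flip, h]

lemma spin_flip_of_ne {x y : ℤ} (h : y ≠ x) (s : Config) : spin y (flip x s) = spin y s := by
  simp [spin, flip, h]

/-- Flipping site `x` preserves the state and reverses the sign of the integrand. -/
lemma expect_spin_mul {f : Observable} (hf : IsLocal f) (x : ℤ)
    (hx : ∀ s, f (flip x s) = f s) : expect (fun s => spin x s * f s) = 0 := by
  have h := expect_comp_flip ((IsLocal.spin x).mul hf) x
  simp only [spin_flip_self, hx] at h
  have h2 := expect_const_mul (-1) (fun s => spin x s * f s)
  have h3 : (fun s => -spin x s * f s) = fun s => -1 * (spin x s * f s) := by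
    funext s; ring
  rw [h3] at h
  linarith

/-- The update of the single site `x` by the local rule. -/
def updateSite (x : ℤ) (s : Config) : Config :=
  Function.update s x (chi (s (x - 1)) (s x) (s (x + 1)))

/-- The update flips `x` or not according to the two neighbours alone, so the state is preserved
conditionally on them. -/
lemma expect_comp_updateSite {f : Observable} (hf : IsLocal f) (x : ℤ) :
    expect (fun s => f (updateSite x s)) = expect f := by
  -- `p` is the indicator that both neighbours are empty, the only case in which `x` is not flipped.
  let p : Observable := fun s => (1 + flipSign (spin (x - 1) s) (spin (x + 1) s)) / 2
  have hp : IsLocal p :=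
    ((IsLocal.spin (x - 1)).flipSign (IsLocal.spin (x + 1))).map fun a => (1 + a) / 2
  have hpf : ∀ s, p (flip x s) = p s := fun s => by
    simp only [p]
    rw [spin_flip_of_ne (by omega), spin_flip_of_ne (by omega)]
  have hq : IsLocal (fun s => 1 - p s) := hp.map fun a => 1 - a
  have hff : IsLocal (fun s => f (flip x s)) := by
    obtain ⟨N, hN⟩ := hf
    obtain ⟨M, hM⟩ := IsLocal.spin x
    refine ⟨max N x.natAbs, fun s s' hs => hN fun i hi => ?_⟩
    have hx : s x = s' x := hs x (by
      simp only [Set.mem_ofPred_eq]; push_cast; exact le_max_right _ _)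
    have hi' : s i = s' i := hs i (by
      simp only [Set.mem_ofPred_eq]; push_cast; exact le_max_of_le_left hi)
    simp only [flip, Function.update_apply, hx, hi']
  have hsplit : ∀ s, f (updateSite x s) = p s * f s + (1 - p s) * f (flip x s) := by
    intro s
    have hchi : ∀ a b c : Fin 2, chi a b c = if a = 0 ∧ c = 0 then b else b + 1 := by decide
    have : updateSite x s = if s (x - 1) = 0 ∧ s (x + 1) = 0 then s else flip x s := by
      unfold updateSite flip
      rw [hchi]
      split_ifs
      · simp
      · rfl
    rw [this]
    by_cases h1 : s (x - 1) = 0 <;> by_cases h2 : s (x + 1) = 0 <;>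
      simp [p, spin, flipSign, h1, h2] <;> norm_num
  have hsplit' : ∀ s, f s = p s * f s + (1 - p s) * f s := fun s => by ring
  calc expect (fun s => f (updateSite x s))
      = expect (fun s => p s * f s + (1 - p s) * f (flip x s)) := by simp only [hsplit]
    _ = expect (fun s => p s * f s) + expect (fun s => (1 - p s) * f (flip x s)) :=
        expect_add (hp.mul hf) (hq.mul hff)
    _ = expect (fun s => p s * f s) + expect (fun s => (1 - p s) * f s) := by
        rw [← expect_comp_flip (hq.mul hf) x]; simp only [hpf]
    _ = expect (fun s => p s * f s + (1 - p s) * f s) := (expect_add (hp.mul hf) (hq.mul hf)).symm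
    _ = expect f := by simp only [← hsplit']

lemma IsLocal.comp_updateSite {f : Observable} (hf : IsLocal f) (x : ℤ) :
    IsLocal (fun s => f (updateSite x s)) := by
  obtain ⟨N, hN⟩ := hf
  refine ⟨N + x.natAbs + 1, fun s s' hs => hN fun i hi => ?_⟩
  have hi' : |i| ≤ (N : ℤ) := hi
  rw [abs_le] at hi'
  have key : ∀ j : ℤ, -(N + x.natAbs + 1 : ℤ) ≤ j → j ≤ N + x.natAbs + 1 → s j = s' j :=
    fun j h1 h2 => hs j (by simp only [Set.mem_ofPred_eq, abs_le]; push_cast at *; omega)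
  simp only [updateSite, Function.update_apply]
  rw [key (x - 1) (by omega) (by omega), key x (by omega) (by omega),
    key (x + 1) (by omega) (by omega), key i (by omega) (by omega)]

/-- The update of the sites in a finite set. -/
def updateOn (A : Finset ℤ) (s : Config) : Config := fun x =>
  if x ∈ A then chi (s (x - 1)) (s x) (s (x + 1)) else s x

/-- Sites of equal parity are never adjacent, so the simultaneous update is a composition of
single-site updates. -/
lemma expect_comp_updateOn (n : ℕ) (A : Finset ℤ) (hA : ∀ x ∈ A, Even (x + n)) :
    ∀ {f : Observable}, IsLocal f → expect (fun s => f (updateOn A s)) = expect f := by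
  induction A using Finset.induction_on with
  | empty => intro f _; rfl
  | insert a A ha ih =>
    intro f hf
    have hAA : ∀ x ∈ A, Even (x + n) := fun x hx => hA x (Finset.mem_insert_of_mem hx)
    have hae := hA a (Finset.mem_insert_self a A)
    have h1 : a - 1 ∉ A := fun h => by
      have := hAA _ h
      rw [show a - 1 + (n : ℤ) = a + n - 1 by ring, Int.even_sub_one] at this
      exact this hae
    have h2 : a + 1 ∉ A := fun h => by
      have := hAA _ h
      rw [show a + 1 + (n : ℤ) = a + n + 1 by ring, Int.even_add_one] at this
      exact this hae
    have hcomp : ∀ s, updateOn (insert a A) s = updateSite a (updateOn A s) := by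
      intro s; funext x
      by_cases hx : x = a
      · subst hx; simp [updateOn, updateSite, ha, h1, h2]
      · simp [updateOn, updateSite, hx]
    simp only [hcomp]
    rw [ih hAA (hf.comp_updateSite a), expect_comp_updateSite hf]

lemma expect_comp_step {f : Observable} (hf : IsLocal f) (n : ℕ) :
    expect (fun s => f (step n s)) = expect f := by
  obtain ⟨N, hN⟩ := id hf
  -- Only the updates inside the support of `f` are visible to it, so a finite set of them replaces
  -- the infinite step.
  let A : Finset ℤ := (Finset.Icc (-(N : ℤ)) N).filter fun x => Even (x + n)
  rw [← expect_comp_updateOn n A (fun x hx => (Finset.mem_filter.1 hx).2) hf]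
  congr 1
  funext s
  refine hN fun i hi => ?_
  have hi' : -(N : ℤ) ≤ i ∧ i ≤ N := abs_le.1 hi
  simp [step_apply, updateOn, A, hi']

/-- The configuration reflected at the origin. -/
def reflect (s : Config) : Config := fun x => s (-x)

lemma expect_comp_reflect {f : Observable} (hf : IsLocal f) :
    expect (fun s => f (reflect s)) = expect f := by
  have hmeas : Measurable reflect := measurable_pi_lambda _ fun i => measurable_pi_apply (-i)
  have hmap : maxEntropyState.map reflect = maxEntropyState := by
    unfold maxEntropyState separableState
    have h := Measure.infinitePi_map_piCongrLeft
      (μ := fun _ : ℤ => (PMF.uniformOfFintype (Fin 2)).toMeasure) (Equiv.neg ℤ)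
    have he : (MeasurableEquiv.piCongrLeft (fun _ : ℤ => Fin 2) (Equiv.neg ℤ) :
        Config → Config) = reflect := by
      funext s x
      have := Equiv.piCongrLeft_apply_apply (fun _ : ℤ => Fin 2) (Equiv.neg ℤ) s (-x)
      simp only [Equiv.neg_apply, neg_neg] at this
      exact this
    rw [he] at h
    exact h
  unfold expect
  conv_rhs => rw [← hmap]
  rw [integral_map hmeas.aemeasurable]
  rw [hmap]; exact hf.integrable.aestronglyMeasurable

lemma isLocal_evolveRec {a : Observable} (ha : IsLocal a) (n : ℕ) : IsLocal (evolveRec n a) := by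
  induction n with
  | zero => exact ha
  | succ n ih => exact ih.comp_step n

/-! ### Correlations with the evolved spin at the origin. -/

/-- The correlation of `f` with the spin at the origin, evolved backwards through the steps
`n - 1, …, 0`. -/
def corr (n : ℕ) (f : Observable) : ℝ := expect fun s => f s * evolveRec n (spin 0) s

/-- Invariance of the state under `step n` together with `step_step` transfers the step to `f`. -/
lemma corr_succ {f : Observable} (hf : IsLocal f) (n : ℕ) :
    corr (n + 1) f = corr n fun s => f (step n s) := by
  unfold corr
  rw [← expect_comp_step ((hf.comp_step n).mul (isLocal_evolveRec (IsLocal.spin 0) n)) n]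
  simp only [step_step]
  rfl

lemma corr_add {f g : Observable} (hf : IsLocal f) (hg : IsLocal g) (n : ℕ) :
    corr n (fun s => f s + g s) = corr n f + corr n g := by
  have hW := isLocal_evolveRec (IsLocal.spin 0) n
  unfold corr
  rw [← expect_add (hf.mul hW) (hg.mul hW)]
  simp only [add_mul]

lemma corr_const_mul (c : ℝ) (f : Observable) (n : ℕ) :
    corr n (fun s => c * f s) = c * corr n f := by
  unfold corr
  rw [← expect_const_mul]
  simp only [mul_assoc]

lemma corr_linear {f g : Observable} (hf : IsLocal f) (hg : IsLocal g) (a b : ℝ) (n : ℕ) :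
    corr n (fun s => a * f s + b * g s) = a * corr n f + b * corr n g := by
  rw [corr_add (hf.map fun u => a * u) (hg.map fun u => b * u), corr_const_mul, corr_const_mul]

lemma corr_sub {f g : Observable} (hf : IsLocal f) (hg : IsLocal g) (n : ℕ) :
    corr n (fun s => f s - g s) = corr n f - corr n g := by
  have h := corr_linear hf hg 1 (-1) n
  rw [show (fun s => f s - g s) = fun s => 1 * f s + -1 * g s by funext s; ring, h]
  ring

lemma corr_congr {f g : Observable} (h : ∀ s, f s = g s) (n : ℕ) : corr n f = corr n g := by
  rw [funext h]

lemma apply_flip_of_lt {f : Observable} {y : ℤ} (hf : DependsOn f (Set.Ici y)) {x : ℤ}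
    (hx : x < y) (s : Config) : f (flip x s) = f s :=
  hf fun i hi => by
    have : i ≠ x := by have : y ≤ i := hi; omega
    simp [flip, this]

lemma corr_zero_spin_mul {f : Observable} (hf : IsLocal f) {x : ℤ} (hx : x ≠ 0)
    (hfx : ∀ s, f (flip x s) = f s) : corr 0 (fun s => spin x s * f s) = 0 := by
  have h := expect_spin_mul (hf.mul (IsLocal.spin 0)) x fun s => by
    rw [hfx, spin_flip_of_ne hx.symm]
  unfold corr
  rw [← h]
  simp only [mul_assoc]
  rfl

/-- After a step the sites from `y` on depend on site `y - 1` as well; pinning its value removes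
that dependence. -/
lemma dependsOn_step_update {f : Observable} {y : ℤ} (hf : DependsOn f (Set.Ici y)) (n : ℕ)
    (a : Fin 2) : DependsOn (fun s => f (step n (Function.update s (y - 1) a))) (Set.Ici y) := by
  intro s s' hs
  refine hf fun i hi => ?_
  have hi' : y ≤ i := hi
  have key : ∀ j, y - 1 ≤ j →
      Function.update s (y - 1) a j = Function.update s' (y - 1) a j := fun j hj => by
    simp only [Function.update_apply]
    split_ifs with h
    · rfl
    · exact hs j (by simp only [Set.mem_Ici]; omega)
  rw [step_apply, step_apply, key (i - 1) (by omega), key i (by omega), key (i + 1) (by omega)]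

lemma dependsOn_step {f : Observable} {y : ℤ} (hf : DependsOn f (Set.Ici y)) {n : ℕ}
    (hy : ¬ Even (y + n)) : DependsOn (fun s => f (step n s)) (Set.Ici y) := by
  intro s s' hs
  refine hf fun i hi => ?_
  have hi' : y ≤ i := hi
  have key : ∀ j, y ≤ j → s j = s' j := fun j hj => hs j hj
  rw [step_apply, step_apply, key i hi']
  split_ifs with h
  · have : i ≠ y := fun h' => hy (h' ▸ h)
    rw [key (i - 1) (by omega), key (i + 1) (by omega)]
  · rfl

lemma dependsOn_spin_mul {f : Observable} {y z : ℤ} (hf : DependsOn f (Set.Ici y)) (hz : z ≤ y)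
    (F : ℝ → ℝ) : DependsOn (fun s => F (spin z s) * f s) (Set.Ici z) := by
  intro s s' hs
  have h1 : f s = f s' := hf fun i hi => hs i (le_trans hz hi)
  have h2 : s z = s' z := hs z (Set.self_mem_Ici)
  simp only [h1, spin, h2]

lemma update_of_spin_eq_one {x : ℤ} {s : Config} (h : spin x s = 1) :
    Function.update s x 0 = s := by
  have h0 : s x = 0 := by
    by_contra h'
    simp [spin, h'] at h
    norm_num at h
  rw [← h0, Function.update_eq_self]

lemma update_of_spin_eq_neg_one {x : ℤ} {s : Config} (h : spin x s = -1) :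
    Function.update s x 1 = s := by
  have hd : ∀ a : Fin 2, a = 0 ∨ a = 1 := by decide
  have h1 : s x = 1 := by
    rcases hd (s x) with h' | h'
    · simp [spin, h'] at h
      norm_num at h
    · exact h'
  rw [← h1, Function.update_eq_self]

lemma flipSign_one_right (a : ℝ) : flipSign a 1 = a := by unfold flipSign; ring
lemma flipSign_neg_one_right (a : ℝ) : flipSign a (-1) = -1 := by unfold flipSign; ring
lemma flipSign_neg_one_left (a : ℝ) : flipSign (-1) a = -1 := by unfold flipSign; ring

/-! ### Null densities. -/

/-- Signed densities whose effect to the right of `y` cancels at all times. -/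
theorem corr_left_spin (n : ℕ) : ∀ (y : ℤ), y ≤ 1 → ∀ φ : Observable, IsLocal φ →
    DependsOn φ (Set.Ici y) →
    (¬ Even (y + n) →
      corr n (fun s => spin (y - 2) s * ((1 + spin (y - 1) s) * φ s)) = 0 ∧
      corr n (fun s => spin (y - 2) s * ((1 - spin (y - 1) s) * ((1 + spin y s) * φ s))) = 0) ∧
    (Even (y + n) →
      corr n (fun s => spin (y - 2) s * ((1 - spin (y - 1) s) * ((1 - spin y s) * φ s))) = 0) := by
  have hadd : ∀ x, IsLocal fun s => 1 + spin x s := fun x => (IsLocal.spin x).map fun a => 1 + a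
  have hsub : ∀ x, IsLocal fun s => 1 - spin x s := fun x => (IsLocal.spin x).map fun a => 1 - a
  induction n with
  -- Since `y ≤ 1`, the free site `y - 2` is not the origin and its spin averages to zero.
  | zero =>
    intro y hy φ hφ hd
    refine ⟨fun _ => ⟨?_, ?_⟩, fun _ => ?_⟩
    · refine corr_zero_spin_mul ((hadd _).mul hφ) (by omega) fun s => ?_
      rw [apply_flip_of_lt hd (by omega), spin_flip_of_ne (by omega)]
    · refine corr_zero_spin_mul ((hsub _).mul ((hadd _).mul hφ)) (by omega) fun s => ?_
      rw [apply_flip_of_lt hd (by omega), spin_flip_of_ne (by omega), spin_flip_of_ne (by omega)]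
    · refine corr_zero_spin_mul ((hsub _).mul ((hsub _).mul hφ)) (by omega) fun s => ?_
      rw [apply_flip_of_lt hd (by omega), spin_flip_of_ne (by omega), spin_flip_of_ne (by omega)]
  | succ n ih =>
    intro y hy φ hφ hd
    have hφ' : ∀ a, IsLocal fun s => φ (step n (Function.update s (y - 1) a)) := fun a =>
      (hφ.comp_step n).comp_update (y - 1) a
    refine ⟨fun hev => ?_, fun hev => ?_⟩
    · push_cast at hev
      have e0 : Even (y + n) := by
        rw [show y + (n + 1 : ℤ) = y + n + 1 by ring, Int.even_add_one, not_not] at hev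
        exact hev
      have e1 : ¬ Even (y - 1 + n) := by
        rw [show y - 1 + (n : ℤ) = y + n - 1 by ring, Int.even_sub_one, not_not]; exact e0
      have e2 : Even (y - 2 + n) := by
        rw [show y - 2 + (n : ℤ) = y - 1 + n - 1 by ring, Int.even_sub_one]; exact e1
      constructor
      -- With `y - 1` empty, the new spin at `y - 2` is the product of the old ones at `y - 2` and
      -- `y - 3`. Splitting by the value at `y - 2` gives the first two densities of the family with
      -- `y` replaced by `y - 1`.
      · rw [corr_succ ((IsLocal.spin _).mul ((hadd _).mul hφ))]
        have hd' := dependsOn_step_update hd n 0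
        obtain ⟨h1, -⟩ := (ih (y - 1) (by omega) _ ((hadd (y - 1)).mul (hφ' 0))
          (dependsOn_spin_mul hd' (by omega) fun a => 1 + a)).1 e1
        obtain ⟨-, h2⟩ := (ih (y - 1) (by omega) _ (hφ' 0)
          (hd'.mono (Set.Ici_subset_Ici.2 (by omega)))).1 e1
        have hl := corr_linear
          ((IsLocal.spin (y - 1 - 2)).mul ((hadd (y - 1 - 1)).mul ((hadd (y - 1)).mul (hφ' 0))))
          ((IsLocal.spin (y - 1 - 2)).mul ((hsub (y - 1 - 1)).mul ((hadd (y - 1)).mul (hφ' 0))))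
          (1 / 2) (-1 / 2) n
        rw [h1, h2] at hl
        rw [corr_congr _ n, hl]
        · ring
        · intro s
          rw [spin_step_of_even e2, spin_step_of_odd e1]
          rw [show y - 2 - 1 = y - 1 - 2 by ring, show y - 2 + 1 = y - 1 by ring,
            show y - 1 - 1 = y - 2 by ring]
          rcases spin_eq_or (y - 1) s with h | h
          · rw [update_of_spin_eq_one h, h, flipSign_one_right]; ring
          · rw [h]; ring
      -- The occupied site `y - 1` flips both `y - 2` and `y`, so the second density turns into
      -- minus the third.
      · rw [corr_succ ((IsLocal.spin _).mul ((hsub _).mul ((hadd _).mul hφ)))]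
        have h4 := (ih y hy _ (hφ' 1) (dependsOn_step_update hd n 1)).2 e0
        have hl := corr_const_mul (-1) (fun s => spin (y - 2) s * ((1 - spin (y - 1) s) *
          ((1 - spin y s) * φ (step n (Function.update s (y - 1) 1))))) n
        rw [h4] at hl
        rw [corr_congr _ n, hl]
        · ring
        · intro s
          rw [spin_step_of_even e2, spin_step_of_odd e1, spin_step_of_even e0]
          rw [show y - 2 + 1 = y - 1 by ring]
          rcases spin_eq_or (y - 1) s with h | h
          · rw [h]; ring
          · rw [update_of_spin_eq_neg_one h, h, flipSign_neg_one_right, flipSign_neg_one_left]; ring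
    · push_cast at hev
      have e0 : ¬ Even (y + n) := by
        rw [show y + (n + 1 : ℤ) = y + n + 1 by ring, Int.even_add_one] at hev
        exact hev
      have e1 : Even (y - 1 + n) := by
        rw [show y - 1 + (n : ℤ) = y + n - 1 by ring, Int.even_sub_one]; exact e0
      have e2 : ¬ Even (y - 2 + n) := by
        rw [show y - 2 + (n : ℤ) = y - 1 + n - 1 by ring, Int.even_sub_one, not_not]; exact e1
      -- The occupied site `y` flips `y - 1`, so the third density turns into the first.
      rw [corr_succ ((IsLocal.spin _).mul ((hsub _).mul ((hsub _).mul hφ)))]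
      obtain ⟨h1, -⟩ := (ih y hy _ ((hsub y).mul (hφ.comp_step n))
        (dependsOn_spin_mul (dependsOn_step hd e0) le_rfl fun a => 1 - a)).1 e0
      rw [← h1]
      refine corr_congr (fun s => ?_) n
      rw [spin_step_of_odd e2, spin_step_of_even e1, spin_step_of_odd e0]
      rw [show y - 1 - 1 = y - 2 by ring, show y - 1 + 1 = y by ring]
      rcases spin_eq_or y s with h | h
      · rw [h]; ring
      · rw [h, flipSign_neg_one_right]; ring

section
variable {n : ℕ} {y : ℤ} {φ : Observable}

/-- The parity condition says that `y` is updated by step `n - 1`, the next one to be transferred.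
The density is half the sum of the first two null densities, which split it by the value at `y - 1`.
-/
lemma corr_active_empty (h : ¬ Even (y + n)) (hy : y ≤ 1) (hφ : IsLocal φ)
    (hd : DependsOn φ (Set.Ici y)) :
    corr n (fun s => spin (y - 2) s * ((1 + spin y s) * φ s)) = 0 := by
  have h1 := ((corr_left_spin n y hy _ (((IsLocal.spin y).map fun a => 1 + a).mul hφ)
    (dependsOn_spin_mul hd le_rfl fun a => 1 + a)).1 h).1
  have h2 := ((corr_left_spin n y hy _ hφ hd).1 h).2
  have hl := corr_linear
    ((IsLocal.spin (y - 2)).mul (((IsLocal.spin (y - 1)).map fun a => 1 + a).mul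
      (((IsLocal.spin y).map fun a => 1 + a).mul hφ)))
    ((IsLocal.spin (y - 2)).mul (((IsLocal.spin (y - 1)).map fun a => 1 - a).mul
      (((IsLocal.spin y).map fun a => 1 + a).mul hφ))) (1 / 2) (1 / 2) n
  rw [h1, h2] at hl
  rw [corr_congr _ n, hl]
  · ring
  · intro s; ring

lemma corr_inactive_empty (h : Even (y + n)) (hy : y ≤ 1) (hφ : IsLocal φ)
    (hd : DependsOn φ (Set.Ici y)) :
    corr n (fun s => spin (y - 2) s * ((1 + spin y s) * φ s)) = 0 := by
  have hloc : IsLocal fun s => (1 + spin y s) * φ s := ((IsLocal.spin y).map fun a => 1 + a).mul hφ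
  cases n with
  | zero =>
    refine corr_zero_spin_mul hloc (by omega) fun s => ?_
    rw [apply_flip_of_lt hd (by omega), spin_flip_of_ne (by omega)]
  | succ n =>
    push_cast at h
    have e0 : ¬ Even (y + n) := by
      rw [show y + (n + 1 : ℤ) = y + n + 1 by ring, Int.even_add_one] at h
      exact h
    have e2 : ¬ Even (y - 2 + n) := by
      rw [show y - 2 + (n : ℤ) = y + n - 1 - 1 by ring, Int.even_sub_one, Int.even_sub_one, not_not]
      exact e0
    rw [corr_succ ((IsLocal.spin _).mul hloc), ← corr_active_empty e0 hy (hφ.comp_step n)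
      (dependsOn_step hd e0)]
    refine corr_congr (fun s => ?_) n
    rw [spin_step_of_odd e2, spin_step_of_odd e0]

/-- One step with `y` empty turns the spin at `y - 1` into its product with the spin at `y - 2`,
half the difference of two null densities. At `n = 0` the free site `y - 1` must itself avoid the
origin, hence the stronger bound on `y` there. -/
lemma corr_inactive_empty_near (h : Even (y + n)) (hy : y ≤ 0 ∨ y ≤ 1 ∧ 1 ≤ n) (hφ : IsLocal φ)
    (hd : DependsOn φ (Set.Ici y)) :
    corr n (fun s => spin (y - 1) s * ((1 + spin y s) * φ s)) = 0 := by
  have hloc : IsLocal fun s => (1 + spin y s) * φ s := ((IsLocal.spin y).map fun a => 1 + a).mul hφ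
  cases n with
  | zero =>
    refine corr_zero_spin_mul hloc (by omega) fun s => ?_
    rw [apply_flip_of_lt hd (by omega), spin_flip_of_ne (by omega)]
  | succ n =>
    push_cast at h
    have e0 : ¬ Even (y + n) := by
      rw [show y + (n + 1 : ℤ) = y + n + 1 by ring, Int.even_add_one] at h
      exact h
    have e1 : Even (y - 1 + n) := by
      rw [show y - 1 + (n : ℤ) = y + n - 1 by ring, Int.even_sub_one]
      exact e0
    have hy1 : y ≤ 1 := by omega
    have hφ' := hφ.comp_step n
    have hd' := dependsOn_step hd e0
    rw [corr_succ ((IsLocal.spin _).mul hloc)]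
    have h1 := ((corr_left_spin n y hy1 _ (((IsLocal.spin y).map fun a => 1 + a).mul hφ')
      (dependsOn_spin_mul hd' le_rfl fun a => 1 + a)).1 e0).1
    have h2 := ((corr_left_spin n y hy1 _ hφ' hd').1 e0).2
    have hl := corr_linear
      ((IsLocal.spin (y - 2)).mul (((IsLocal.spin (y - 1)).map fun a => 1 + a).mul
        (((IsLocal.spin y).map fun a => 1 + a).mul hφ')))
      ((IsLocal.spin (y - 2)).mul (((IsLocal.spin (y - 1)).map fun a => 1 - a).mul
        (((IsLocal.spin y).map fun a => 1 + a).mul hφ'))) (1 / 2) (-1 / 2) n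
    rw [h1, h2] at hl
    rw [corr_congr _ n, hl]
    · ring
    · intro s
      rw [spin_step_of_odd e0, spin_step_of_even e1]
      rw [show y - 1 - 1 = y - 2 by ring, show y - 1 + 1 = y by ring]
      rcases spin_eq_or y s with h | h
      · rw [h, flipSign_one_right]; ring
      · rw [h]; ring

end

/-! ### Recursion for the spatial differences. -/

lemma corr_eq_of_null {f g h₁ h₂ : Observable} {n : ℕ} (hg : IsLocal g) (l₁ : IsLocal h₁)
    (l₂ : IsLocal h₂) (n₁ : corr n h₁ = 0) (n₂ : corr n h₂ = 0) (a b : ℝ)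
    (hf : ∀ s, f s = g s + (a * h₁ s + b * h₂ s)) : corr n f = corr n g := by
  rw [corr_congr hf, corr_add hg ((l₁.map fun u => a * u).add (l₂.map fun u => b * u)),
    corr_linear l₁ l₂, n₁, n₂]
  ring

lemma dependsOn_one (y : ℤ) : DependsOn (fun _ : Config => (1 : ℝ)) (Set.Ici y) := fun _ _ _ => rfl

/-- Splitting `spin x` by the values at `x + 1` and `x + 2`, only the part with `x + 1` empty and `x
+ 2` occupied is not null; the step then makes `x + 1` occupied. -/
lemma corr_spin_sub_succ {x : ℤ} {k : ℕ} (h : ¬ Even (x + k)) (hx : x ≤ -1) :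
    corr (k + 1) (fun s => spin (x + 2) s - spin x s) =
      corr k (fun s => spin (x + 2) s -
        1 / 4 * (spin x s * (1 - spin (x + 1) s) * (1 - spin (x + 2) s))) := by
  have ev : Even (x + 2 + (k + 1 : ℕ)) := by
    push_cast
    rw [show x + 2 + (k + 1 : ℤ) = x + k + 1 + 1 + 1 by ring, Int.even_add_one, Int.even_add_one,
      Int.even_add_one, not_not]
    exact h
  have h3 := corr_inactive_empty ev (by omega) (IsLocal.const 1) (dependsOn_one _)
  have h4 := (corr_left_spin (k + 1) (x + 2) (by omega) _ (IsLocal.const 1) (dependsOn_one _)).2 ev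
  rw [show x + 2 - 2 = x by ring] at h3 h4
  rw [show x + 2 - 1 = x + 1 by ring] at h4
  have e1 : Even (x + 1 + k) := by
    rw [show x + 1 + (k : ℤ) = x + k + 1 by ring, Int.even_add_one]; exact h
  have e2 : ¬ Even (x + 2 + k) := by
    rw [show x + 2 + (k : ℤ) = x + 1 + k + 1 by ring, Int.even_add_one, not_not]; exact e1
  have hg : IsLocal fun s => spin (x + 2) s -
      1 / 4 * (spin x s * (1 + spin (x + 1) s) * (1 - spin (x + 2) s)) := by
    repeat' first | exact IsLocal.spin _ | exact IsLocal.const _ | apply IsLocal.mul |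
      apply IsLocal.sub | apply IsLocal.add
  rw [corr_eq_of_null hg _ _ h3 h4 (-1 / 2) (-1 / 4), corr_succ hg]
  · refine corr_congr (fun s => ?_) k
    rw [spin_step_of_odd h, spin_step_of_even e1, spin_step_of_odd e2]
    rw [show x + 1 + 1 = x + 2 by ring]
    rcases spin_eq_or (x + 2) s with h | h
    · rw [h]; ring
    · rw [h, flipSign_neg_one_right]; ring
  · intro s; ring
  · repeat' first | exact IsLocal.spin _ | exact IsLocal.const _ | apply IsLocal.mul |
      apply IsLocal.sub | apply IsLocal.add
  · repeat' first | exact IsLocal.spin _ | exact IsLocal.const _ | apply IsLocal.mul |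
      apply IsLocal.sub

lemma corr_spin_sub_add_two {x : ℤ} {n : ℕ} (h : Even (x + n + 1)) (hx : x ≤ -2) :
    corr (n + 3) (fun s => spin (x + 2) s - spin x s) =
      corr (n + 1) (fun s => -1 / 2 * (spin (x + 2) s * (1 - spin (x + 3) s)) -
        1 / 4 * (spin x s * (1 + spin (x + 1) s) * (1 + spin (x + 2) s))) := by
  have ev0 : Even (x + (n + 1 : ℕ)) := by push_cast; rw [← add_assoc]; exact h
  have ev1 : ¬ Even (x + 1 + (n + 1 : ℕ)) := by
    rw [show x + 1 + ((n + 1 : ℕ) : ℤ) = x + (n + 1 : ℕ) + 1 by ring, Int.even_add_one, not_not]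
    exact ev0
  have ev2 : Even (x + 2 + (n + 1 : ℕ)) := by
    rw [show x + 2 + ((n + 1 : ℕ) : ℤ) = x + 1 + (n + 1 : ℕ) + 1 by ring, Int.even_add_one]
    exact ev1
  have ev3 : ¬ Even (x + 3 + (n + 1 : ℕ)) := by
    rw [show x + 3 + ((n + 1 : ℕ) : ℤ) = x + 2 + (n + 1 : ℕ) + 1 by ring, Int.even_add_one, not_not]
    exact ev2
  have ev : ¬ Even (x + (n + 2 : ℕ)) := by
    rw [show x + ((n + 2 : ℕ) : ℤ) = x + (n + 1 : ℕ) + 1 by push_cast; ring, Int.even_add_one,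
      not_not]
    exact ev0
  rw [corr_spin_sub_succ (k := n + 2) ev (by omega)]
  have hl : IsLocal fun s => spin (x + 2) s -
      1 / 4 * (spin x s * (1 - spin (x + 1) s) * (1 - spin (x + 2) s)) := by
    repeat' first | exact IsLocal.spin _ | exact IsLocal.const _ | apply IsLocal.mul |
      apply IsLocal.sub
  rw [corr_succ hl]
  have h3 := corr_inactive_empty ev2 (by omega) (IsLocal.const 1) (dependsOn_one _)
  obtain ⟨h1, h2⟩ := (corr_left_spin (n + 1) (x + 3) (by omega) _
    (((IsLocal.spin (x + 3)).map fun a => 1 + a).mul (IsLocal.const 1))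
    (dependsOn_spin_mul (dependsOn_one (x + 3)) le_rfl fun a => 1 + a)).1 ev3
  rw [show x + 2 - 2 = x by ring] at h3
  rw [show x + 3 - 2 = x + 1 by ring, show x + 3 - 1 = x + 2 by ring] at h1 h2
  have hg : IsLocal fun s => -1 / 2 * (spin (x + 2) s * (1 - spin (x + 3) s)) -
        1 / 4 * (spin x s * (1 + spin (x + 1) s) * (1 + spin (x + 2) s)) := by
    repeat' first | exact IsLocal.spin _ | exact IsLocal.const _ | apply IsLocal.mul |
      apply IsLocal.sub | apply IsLocal.add
  have l1 : IsLocal fun s =>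
      spin (x + 1) s * ((1 + spin (x + 2) s) * ((1 + spin (x + 3) s) * 1)) := by
    repeat' first | exact IsLocal.spin _ | exact IsLocal.const _ | apply IsLocal.mul |
      apply IsLocal.sub | apply IsLocal.add
  have l2 : IsLocal fun s => spin (x + 1) s *
      ((1 - spin (x + 2) s) * ((1 + spin (x + 3) s) * ((1 + spin (x + 3) s) * 1))) := by
    repeat' first | exact IsLocal.spin _ | exact IsLocal.const _ | apply IsLocal.mul |
      apply IsLocal.sub | apply IsLocal.add
  have l3 : IsLocal fun s => spin x s * ((1 + spin (x + 2) s) * 1) := by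
    repeat' first | exact IsLocal.spin _ | exact IsLocal.const _ | apply IsLocal.mul |
      apply IsLocal.sub | apply IsLocal.add
  have h12 := corr_linear l1 l2 (1 / 4) (-1 / 8) (n + 1)
  rw [h1, h2] at h12
  rw [corr_eq_of_null hg ((l1.map fun u => 1 / 4 * u).add (l2.map fun u => -1 / 8 * u)) l3
    (h12.trans (by ring)) h3 1 (1 / 2)]
  intro s
  rw [spin_step_of_even ev0, spin_step_of_odd ev1, spin_step_of_even ev2,
    show x + 2 - 1 = x + 1 by ring, show x + 2 + 1 = x + 3 by ring]
  rcases spin_eq_or (x + 1) s with a | a <;> rcases spin_eq_or (x + 2) s with b | b <;>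
    rcases spin_eq_or (x + 3) s with c | c <;> rw [a, b, c] <;> unfold flipSign <;> ring

/-- The recursion of the spatial differences of the correlations: the difference moves by one site
in one time step or in three, each with weight `1 / 2`. -/
theorem corr_spin_sub_recursion {x : ℤ} {n : ℕ} (h : Even (x + n + 1))
    (hx : x ≤ -3 ∨ x ≤ -2 ∧ 1 ≤ n) :
    corr (n + 3) (fun s => spin (x + 2) s - spin x s) =
      1 / 2 * corr (n + 2) (fun s => spin (x + 3) s - spin (x + 1) s) +
      1 / 2 * corr n (fun s => spin (x + 3) s - spin (x + 1) s) := by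
  have ev0 : ¬ Even (x + n) := by rwa [Int.even_add_one] at h
  have ev1 : Even (x + 1 + n) := by
    rw [show x + 1 + (n : ℤ) = x + n + 1 by ring]; exact h
  have ev2 : ¬ Even (x + 2 + n) := by
    rw [show x + 2 + (n : ℤ) = x + 1 + n + 1 by ring, Int.even_add_one, not_not]; exact ev1
  have ev3 : Even (x + 3 + n) := by
    rw [show x + 3 + (n : ℤ) = x + 2 + n + 1 by ring, Int.even_add_one]; exact ev2
  have ev : ¬ Even (x + 1 + (n + 1 : ℕ)) := by
    rw [show x + 1 + ((n + 1 : ℕ) : ℤ) = x + 1 + n + 1 by push_cast; ring, Int.even_add_one,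
      not_not]
    exact ev1
  have hB := corr_spin_sub_succ (k := n + 1) ev (by omega)
  rw [show x + 1 + 2 = x + 3 by ring, show x + 1 + 1 = x + 2 by ring] at hB
  rw [corr_spin_sub_add_two h (by omega), hB]
  have lA : IsLocal fun s => -1 / 2 * (spin (x + 2) s * (1 - spin (x + 3) s)) -
        1 / 4 * (spin x s * (1 + spin (x + 1) s) * (1 + spin (x + 2) s)) := by
    repeat' first | exact IsLocal.spin _ | exact IsLocal.const _ | apply IsLocal.mul |
      apply IsLocal.sub | apply IsLocal.add
  have lB : IsLocal fun s => spin (x + 3) s -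
        1 / 4 * (spin (x + 1) s * (1 - spin (x + 2) s) * (1 - spin (x + 3) s)) := by
    repeat' first | exact IsLocal.spin _ | exact IsLocal.const _ | apply IsLocal.mul |
      apply IsLocal.sub
  have lC : IsLocal fun s => spin (x + 3) s - spin (x + 1) s :=
    (IsLocal.spin _).sub (IsLocal.spin _)
  -- Both sides are now correlations at the same time `n`; their densities differ by a combination
  -- of three null ones.
  rw [corr_succ lA, corr_succ lB, ← corr_linear (lB.comp_step n) lC]
  have h3 := corr_active_empty ev2 (by omega) (IsLocal.const 1) (dependsOn_one _)
  rw [show x + 2 - 2 = x by ring] at h3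
  have h4 := (corr_left_spin n (x + 3) (by omega) _ (IsLocal.const 1) (dependsOn_one _)).2 ev3
  -- Applied at `y = x + 3`, this is what requires the case distinction in `hx`.
  have h5 := corr_inactive_empty_near ev3 (by omega) (IsLocal.const 1) (dependsOn_one _)
  rw [show x + 3 - 2 = x + 1 by ring, show x + 3 - 1 = x + 2 by ring] at h4
  rw [show x + 3 - 1 = x + 2 by ring] at h5
  have l3 : IsLocal fun s => spin x s * ((1 + spin (x + 2) s) * 1) := by
    repeat' first | exact IsLocal.spin _ | exact IsLocal.const _ | apply IsLocal.mul |
      apply IsLocal.sub | apply IsLocal.add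
  have l4 : IsLocal fun s =>
      spin (x + 1) s * ((1 - spin (x + 2) s) * ((1 - spin (x + 3) s) * 1)) := by
    repeat' first | exact IsLocal.spin _ | exact IsLocal.const _ | apply IsLocal.mul |
      apply IsLocal.sub
  have l5 : IsLocal fun s => spin (x + 2) s * ((1 + spin (x + 3) s) * 1) := by
    repeat' first | exact IsLocal.spin _ | exact IsLocal.const _ | apply IsLocal.mul |
      apply IsLocal.sub | apply IsLocal.add
  have h34 := corr_linear l3 l4 (-1 / 4) (1 / 8) n
  rw [h3, h4] at h34
  refine corr_eq_of_null (((lB.comp_step n).map fun u => 1 / 2 * u).add (lC.map fun u => 1 / 2 * u))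
    ((l3.map fun u => -1 / 4 * u).add (l4.map fun u => 1 / 8 * u)) l5
    (h34.trans (by ring)) h5 1 (-1 / 2) fun s => ?_
  rw [spin_step_of_odd ev0, spin_step_of_even ev1, spin_step_of_odd ev2, spin_step_of_even ev3,
    show x + 1 - 1 = x by ring, show x + 1 + 1 = x + 2 by ring, show x + 3 - 1 = x + 2 by ring]
  rcases spin_eq_or x s with a | a <;> rcases spin_eq_or (x + 1) s with b | b <;>
    rcases spin_eq_or (x + 2) s with c | c <;> rcases spin_eq_or (x + 3) s with d | d <;>
    rw [a, b, c, d] <;> unfold flipSign <;> ring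

/-! ### Reflection symmetry and initial values. -/

lemma step_reflect (n : ℕ) (s : Config) : step n (reflect s) = reflect (step n s) := by
  have hchi : ∀ a b c : Fin 2, chi a b c = chi c b a := by decide
  funext x
  have he : Even (-x + n) ↔ Even (x + n) := by
    rw [Int.even_add, Int.even_add, even_neg]
  unfold reflect
  rw [step_apply, step_apply]
  simp only [he]
  split_ifs
  · rw [hchi]
    congr 2 <;> ring
  · rfl

lemma evolveRec_spin_reflect (n : ℕ) :
    ∀ s, evolveRec n (spin 0) (reflect s) = evolveRec n (spin 0) s := by
  induction n with
  | zero => intro s; simp [evolveRec, spin, reflect]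
  | succ n ih =>
    intro s
    change evolveRec n (spin 0) (step n (reflect s)) = evolveRec n (spin 0) (step n s)
    rw [step_reflect, ih]

lemma corr_spin_neg (n : ℕ) (x : ℤ) : corr n (spin (-x)) = corr n (spin x) := by
  unfold corr
  rw [← expect_comp_reflect ((IsLocal.spin x).mul (isLocal_evolveRec (IsLocal.spin 0) n))]
  simp only [evolveRec_spin_reflect]
  rfl

lemma corr_zero_spin {x : ℤ} (hx : x ≠ 0) : corr 0 (spin x) = 0 := by
  have h := corr_zero_spin_mul (IsLocal.const 1) hx fun _ => rfl
  simpa using h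

lemma spin_mul_self (x : ℤ) (s : Config) : spin x s * spin x s = 1 := by
  rcases spin_eq_or x s with h | h <;> rw [h] <;> norm_num

lemma corr_zero_spin_self : corr 0 (spin 0) = 1 := by
  unfold corr
  have : (fun s => spin 0 s * evolveRec 0 (spin 0) s) = fun _ => 1 := by
    funext s; exact spin_mul_self 0 s
  rw [this, expect_const]

lemma evolveRec_one_spin (s : Config) :
    evolveRec 1 (spin 0) s = spin 0 s * flipSign (spin (-1) s) (spin 1 s) := by
  change spin 0 (step 0 s) = _
  rw [spin_step_of_even (by simp)]
  norm_num

lemma corr_one_spin {x : ℤ} (hx : ¬ Even x) : corr 1 (spin x) = 0 := by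
  have h0 : x ≠ 0 := by rintro rfl; simp at hx
  have h := expect_spin_mul
    ((IsLocal.spin x).mul ((IsLocal.spin (-1)).flipSign (IsLocal.spin 1))) 0 fun s => by
      rw [spin_flip_of_ne h0, spin_flip_of_ne (by omega), spin_flip_of_ne (by omega)]
  unfold corr
  rw [← h]
  congr 1
  funext s
  rw [evolveRec_one_spin]
  ring

lemma corr_one_spin_of_even {x : ℤ} (hx : Even x) (h0 : x ≠ 0) : corr 1 (spin x) = 0 := by
  have h1 : x ≠ 1 := by rintro rfl; simp at hx
  have h2 : x ≠ -1 := by rintro rfl; simp at hx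
  have h := expect_spin_mul
    ((IsLocal.spin 0).mul ((IsLocal.spin (-1)).flipSign (IsLocal.spin 1))) x fun s => by
      rw [spin_flip_of_ne h0.symm, spin_flip_of_ne h2.symm, spin_flip_of_ne h1.symm]
  unfold corr
  rw [← h]
  simp only [evolveRec_one_spin]

lemma expect_spin (x : ℤ) : expect (spin x) = 0 := by
  have h := expect_spin_mul (IsLocal.const 1) x fun _ => rfl
  simpa using h

lemma corr_one_spin_self : corr 1 (spin 0) = -1 / 2 := by
  have e : (fun s => spin 0 s * evolveRec 1 (spin 0) s) = fun s =>
      (1 / 2 * spin (-1) s + 1 / 2 * (spin 1 s * (1 + spin (-1) s))) + -1 / 2 := by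
    funext s
    rw [evolveRec_one_spin, ← mul_assoc, spin_mul_self]
    unfold flipSign
    ring
  have l1 : IsLocal fun s => 1 / 2 * spin (-1) s := (IsLocal.spin _).map fun u => 1 / 2 * u
  have l3 : IsLocal fun s => 1 + spin (-1) s := (IsLocal.spin (-1)).map fun u => 1 + u
  have l2 : IsLocal fun s => 1 / 2 * (spin 1 s * (1 + spin (-1) s)) :=
    ((IsLocal.spin 1).mul l3).map fun u => 1 / 2 * u
  have h := expect_spin_mul l3 1 fun s => by rw [spin_flip_of_ne (by omega)]
  unfold corr
  rw [e, expect_add (l1.add l2) (IsLocal.const _), expect_add l1 l2, expect_const_mul,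
    expect_const_mul, h, expect_spin, expect_const]
  ring

lemma corr_succ_spin {x : ℤ} {n : ℕ} (h : ¬ Even (x + n)) :
    corr (n + 1) (spin x) = corr n (spin x) := by
  rw [corr_succ (IsLocal.spin x)]
  exact corr_congr (fun s => spin_step_of_odd h s) n

lemma corr_two_spin {x : ℤ} (hx : Even x) (h0 : x ≠ 0) : corr 2 (spin x) = 0 := by
  rw [corr_succ_spin (n := 1) (by simpa [Int.even_add_one] using hx), corr_one_spin_of_even hx h0]

lemma corr_two_spin_self : corr 2 (spin 0) = -1 / 2 := by
  rw [corr_succ_spin (n := 1) (by simp), corr_one_spin_self]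

/-- The difference of the correlations at two sites at distance two. -/
def corrDiff (x : ℤ) (t : ℕ) : ℝ := corr t (spin (x + 2)) - corr t (spin x)

lemma corrDiff_recursion {x : ℤ} {n : ℕ} (h : Even (x + n + 1)) (hx : x ≤ -3 ∨ x ≤ -2 ∧ 1 ≤ n) :
    corrDiff x (n + 3) = 1 / 2 * corrDiff (x + 1) (n + 2) + 1 / 2 * corrDiff (x + 1) n := by
  have hr := corr_spin_sub_recursion h hx
  simp only [corr_sub (IsLocal.spin _) (IsLocal.spin _)] at hr
  unfold corrDiff
  rw [show x + 1 + 2 = x + 3 by ring]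
  exact hr

lemma corrDiff_reflect (x : ℤ) (t : ℕ) : corrDiff (-x - 2) t = -corrDiff x t := by
  unfold corrDiff
  rw [show -x - 2 + 2 = -x by ring, show -x - 2 = -(x + 2) by ring, corr_spin_neg, corr_spin_neg]
  ring

lemma corrDiff_neg_one (t : ℕ) : corrDiff (-1) t = 0 := by
  have h := corrDiff_reflect (-1) t
  norm_num at h
  linarith

/-- The recursion leads to site `-1`, where reflection makes the difference vanish. It is
unavailable at `t = 2`, the source of the exceptional case. -/
lemma corrDiff_neg_two {t : ℕ} (ht : Even t) (h4 : 4 ≤ t) : corrDiff (-2) t = 0 := by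
  obtain ⟨n, rfl⟩ : ∃ n, t = n + 3 := ⟨t - 3, by omega⟩
  have he : Even (-2 + (n : ℤ) + 1) := by
    obtain ⟨r, hr⟩ := ht
    exact ⟨r - 2, by omega⟩
  rw [corrDiff_recursion he (Or.inr ⟨by norm_num, by omega⟩)]
  norm_num [corrDiff_neg_one]

lemma corrDiff_neg_two_two : corrDiff (-2) 2 = -1 / 2 := by
  unfold corrDiff
  rw [show (-2 : ℤ) + 2 = 0 by norm_num, corr_two_spin_self, corr_two_spin (by decide) (by norm_num)]
  norm_num

/-! ### Solution of the recursion by binomial coefficients. -/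

lemma binom_of_neg {n k : ℤ} (hk : k < 0) : binom n k = 0 := by
  unfold binom
  rw [if_neg (by omega)]

lemma binom_succ (n : ℕ) (k : ℤ) :
    binom ((n : ℤ) + 1) k = binom n k + binom n (k - 1) := by
  rcases lt_trichotomy k 0 with hk | hk | hk
  · rw [binom_of_neg hk, binom_of_neg hk, binom_of_neg (by omega)]; ring
  · subst hk
    rw [binom_of_neg (k := 0 - 1) (by norm_num)]
    unfold binom
    rw [if_pos (by omega), if_pos (by omega)]
    simp
  · obtain ⟨j, rfl⟩ : ∃ j : ℕ, k = (j : ℤ) + 1 := ⟨(k - 1).toNat, by omega⟩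
    unfold binom
    rw [if_pos (by omega), if_pos (by omega), if_pos (by omega)]
    rw [show ((n : ℤ) + 1).toNat = n + 1 by omega, show ((j : ℤ) + 1).toNat = j + 1 by omega,
      show ((j : ℤ) + 1 - 1).toNat = j by omega, show (n : ℤ).toNat = n by omega,
      Nat.choose_succ_succ]
    push_cast
    ring

lemma binom_zero_left (k : ℤ) : binom 0 k = if k = 0 then 1 else 0 := by
  unfold binom
  rcases lt_trichotomy k 0 with hk | hk | hk
  · rw [if_neg (by omega), if_neg (by omega)]
  · subst hk; simp
  · rw [if_pos (by omega), if_neg (by omega), Nat.choose_eq_zero_of_lt (by omega)]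
    simp

/-- Only `t = 3` and `t = 5` give nonzero values, `1/4` and `-1/4`: they come from the differences
at site `-2` at times `0` and `2`, equal to `1` and `-1/2`. -/
lemma corrDiff_neg_three {k : ℤ} {t : ℕ} (ht : (t : ℤ) = 2 * k + 3) :
    corrDiff (-3) t = 1 / 4 * (binom 0 k - binom 0 (k - 1)) := by
  rw [binom_zero_left, binom_zero_left]
  obtain ht1 | ht3 : t = 1 ∨ 3 ≤ t := by omega
  · subst ht1
    have hk : k = -1 := by omega
    subst hk
    unfold corrDiff
    rw [corr_one_spin (by decide), corr_one_spin (by decide)]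
    norm_num
  · obtain ⟨n, rfl⟩ : ∃ n, t = n + 3 := ⟨t - 3, by omega⟩
    push_cast at ht
    rw [corrDiff_recursion ⟨k - 1, by omega⟩ (Or.inl le_rfl)]
    norm_num
    rcases Nat.lt_or_ge n 1 with h0 | h0
    · have hn : n = 0 := by omega
      subst hn
      have hk : k = 0 := by omega
      subst hk
      rw [corrDiff_neg_two_two]
      unfold corrDiff
      rw [show (-2 : ℤ) + 2 = 0 by norm_num, corr_zero_spin_self, corr_zero_spin (by norm_num)]
      norm_num
    · have hne : Even n := ⟨k.toNat, by omega⟩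
      have hne2 : Even (n + 2) := ⟨k.toNat + 1, by omega⟩
      rw [corrDiff_neg_two hne2 (by omega)]
      rcases Nat.lt_or_ge n 3 with h3 | h3
      · have hn : n = 2 := by rcases hne with ⟨r, hr⟩; omega
        subst hn
        have hk : k = 1 := by omega
        subst hk
        rw [corrDiff_neg_two_two]
        norm_num
      · rw [corrDiff_neg_two hne (by rcases hne with ⟨r, hr⟩; omega), if_neg (by omega),
          if_neg (by omega)]
        norm_num

theorem corrDiff_eq (n : ℕ) : ∀ (k : ℤ) (t : ℕ), (t : ℤ) = 2 * k + n + 3 →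
    corrDiff (-3 - n) t = 1 / 2 ^ (n + 2) * (binom n k - binom n (k - 1)) := by
  induction n with
  | zero =>
    intro k t ht
    have := corrDiff_neg_three (k := k) (t := t) (by push_cast at ht; omega)
    norm_num at this ⊢
    exact this
  | succ n ih =>
    intro k t ht
    push_cast at ht ⊢
    rw [binom_succ, binom_succ]
    rcases Nat.lt_or_ge t 3 with h3 | h3
    · rw [binom_of_neg (k := k) (by omega), binom_of_neg (k := k - 1) (by omega),
        binom_of_neg (k := k - 1 - 1) (by omega)]
      unfold corrDiff
      have : t = 0 ∨ t = 1 ∨ t = 2 := by omega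
      rcases this with rfl | rfl | rfl
      · rw [corr_zero_spin (by omega), corr_zero_spin (by omega)]; ring
      · rw [corr_one_spin, corr_one_spin]
        · ring
        · rintro ⟨r, hr⟩; omega
        · rintro ⟨r, hr⟩; omega
      · rw [corr_two_spin ⟨k, by omega⟩ (by omega),
          corr_two_spin ⟨k - 1, by omega⟩ (by omega)]
        ring
    · obtain ⟨m, rfl⟩ : ∃ m, t = m + 3 := ⟨t - 3, by omega⟩
      push_cast at ht
      -- The terms delayed by one and by three steps carry `k` and `k - 1`, so the recursion is
      -- Pascal's rule with a factor `1/2`.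
      rw [corrDiff_recursion ⟨k - 1, by omega⟩ (Or.inl (by omega)),
        show -3 - ((n : ℤ) + 1) + 1 = -3 - n by ring,
        ih k (m + 2) (by push_cast; omega), ih (k - 1) m (by omega)]
      field_simp
      ring

/-! ### From correlations to the structure factor, and the two orders of evolution. -/

lemma siteObs_one (x : ℤ) (s : Config) : siteObs 1 x s = (1 - spin x s) / 2 := by
  have hd : ∀ a : Fin 2, a = 0 ∨ a = 1 := by decide
  rcases hd (s x) with h | h <;> simp [siteObs, spin, h]

lemma densityCov_eq {W : Observable} (hW : IsLocal W) (x : ℤ) :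
    densityCov x (fun s => (1 - W s) / 2) = 1 / 4 * expect fun s => spin x s * W s := by
  have hx := IsLocal.spin x
  have hhalf : ∀ {V : Observable}, IsLocal V →
      expect (fun s => (1 - V s) / 2) = 1 / 2 * (1 - expect V) := fun {V} hV => by
    rw [← expect_const (1 : ℝ), ← expect_sub (IsLocal.const 1) hV, ← expect_const_mul, expect_const]
    congr 1
    funext s
    ring
  have hsite : siteObs 1 x = fun s => (1 - spin x s) / 2 := funext (siteObs_one x)
  unfold densityCov
  rw [hsite, hhalf hx, hhalf hW, expect_spin]
  have hprod : (fun s => (1 - spin x s) / 2 * ((1 - W s) / 2)) =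
      fun s => 1 / 4 * ((1 - spin x s) - (W s - spin x s * W s)) := by
    funext s; ring
  rw [hprod, expect_const_mul, expect_sub ((IsLocal.const 1).sub hx) (hW.sub (hx.mul hW)),
    expect_sub (IsLocal.const 1) hx, expect_sub hW (hx.mul hW), expect_const, expect_spin]
  ring

lemma evolveRec_comp (F : ℝ → ℝ) (a : Observable) (n : ℕ) :
    ∀ s, evolveRec n (fun s => F (a s)) s = F (evolveRec n a s) := by
  induction n with
  | zero => intro s; rfl
  | succ n ih => intro s; exact ih (step n s)

lemma structureFactorRec_eq (x : ℤ) (t : ℕ) :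
    structureFactorRec x t = 1 / 4 * corr t (spin x) := by
  unfold structureFactorRec corr
  rw [← densityCov_eq (isLocal_evolveRec (IsLocal.spin 0) t), funext (siteObs_one 0)]
  congr 1
  exact funext (evolveRec_comp (fun a => (1 - a) / 2) (spin 0) t)

lemma step_two_mul (j : ℕ) : step (2 * j) = step 0 := by simp [step]

lemma step_two_mul_add_one (j : ℕ) : step (2 * j + 1) = step 1 := by simp [step]

lemma flow_two_mul (j : ℕ) (s : Config) : flow s (2 * j) = (step 1 ∘ step 0)^[j] s := by
  induction j with
  | zero => rfl
  | succ j ih =>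
    rw [Function.iterate_succ_apply', ← ih]
    change step (2 * j + 1) (step (2 * j) (flow s (2 * j))) = _
    rw [step_two_mul, step_two_mul_add_one]
    rfl

lemma evolveRec_two_mul (a : Observable) (j : ℕ) :
    ∀ s, evolveRec (2 * j) a s = a ((step 0 ∘ step 1)^[j] s) := by
  induction j with
  | zero => intro s; rfl
  | succ j ih =>
    intro s
    change evolveRec (2 * j) a (step (2 * j) (step (2 * j + 1) s)) = _
    rw [ih, step_two_mul, step_two_mul_add_one]
    rfl

/-- `step` has period two in time, so an odd number of steps from time `0` reads the same in both
orders. -/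
lemma evolveRec_odd (a : Observable) (j : ℕ) (s : Config) :
    evolveRec (2 * j + 1) a s = a (flow s (2 * j + 1)) := by
  change evolveRec (2 * j) a (step (2 * j) s) = a (step (2 * j) (flow s (2 * j)))
  rw [evolveRec_two_mul, step_two_mul, flow_two_mul]
  have h : Function.Semiconj (step 0) (step 1 ∘ step 0) (step 0 ∘ step 1) := fun _ => rfl
  rw [(h.iterate_right j).eq]

/-- For even `t` the last step of the flow fixes the origin and step `t - 1` fixes `x`, since `x +
t` is even; both orders thus reduce to the odd time `t - 1`. -/
lemma spin_flow_eq_evolveRec {x : ℤ} {t : ℕ} (ht : 1 ≤ t) (hxt : Even (x + t)) :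
    (∀ s, spin 0 (flow s t) = evolveRec t (spin 0) s) ∨
    (∀ s, spin 0 (flow s t) = evolveRec (t - 1) (spin 0) s) ∧
      corr t (spin x) = corr (t - 1) (spin x) := by
  rcases Nat.even_or_odd' t with ⟨j, rfl | rfl⟩
  · obtain ⟨i, rfl⟩ : ∃ i, j = i + 1 := ⟨j - 1, by omega⟩
    right
    rw [show 2 * (i + 1) - 1 = 2 * i + 1 by omega]
    refine ⟨fun s => ?_, ?_⟩
    · rw [evolveRec_odd]
      change spin 0 (step (2 * i + 1) (flow s (2 * i + 1))) = _
      rw [spin_step_of_odd (by simp)]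
    · rw [show 2 * (i + 1) = 2 * i + 1 + 1 by ring, corr_succ_spin]
      rintro ⟨r, hr⟩
      obtain ⟨q, hq⟩ := hxt
      push_cast at *
      omega
  · left
    intro s
    rw [evolveRec_odd]

lemma structureFactor_eq {x : ℤ} {t : ℕ} (ht : 1 ≤ t) (hxt : Even (x + t)) :
    structureFactor x t = 1 / 4 * corr t (spin x) := by
  have key : ∀ n, (∀ s, spin 0 (flow s t) = evolveRec n (spin 0) s) →
      structureFactor x t = 1 / 4 * corr n (spin x) := fun n hn => by
    unfold structureFactor corr
    rw [← densityCov_eq (isLocal_evolveRec (IsLocal.spin 0) n)]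
    congr 1
    funext s
    rw [← hn]
    exact siteObs_one 0 (flow s t)
  rcases spin_flow_eq_evolveRec ht hxt with h | ⟨h, hc⟩
  · exact key t h
  · rw [hc]; exact key _ h

/-! ### Closed form of the scaled difference. -/

lemma scaledDiff_eq {x : ℤ} {t : ℕ} (ht : 1 ≤ t) (hxt : Even (x + t)) :
    scaledDiff x t = 2 ^ (2 * t + 1) * (1 / 4 * corrDiff x t) := by
  have h2 : Even (x + 2 + t) := by
    obtain ⟨r, hr⟩ := hxt
    exact ⟨r + 1, by omega⟩
  unfold scaledDiff corrDiff
  rw [structureFactor_eq ht hxt, structureFactor_eq ht h2]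
  ring

lemma corrDiff_of_le_neg_three {x : ℤ} {t : ℕ} (hxt : Even (x + t)) (hx : x ≤ -3) :
    corrDiff x t = (2 : ℝ) ^ (x + 1) *
      (binom (-x - 3) ((x + t) / 2) - binom (-x - 3) ((x + t - 2) / 2)) := by
  obtain ⟨n, hn⟩ : ∃ n : ℕ, -x - 3 = n := ⟨(-x - 3).toNat, by omega⟩
  obtain ⟨r, hr⟩ := hxt
  have h := corrDiff_eq n r t (by omega)
  rw [hn, show x + (t : ℤ) = 2 * r by omega, show (2 * r : ℤ) / 2 = r by omega,
    show (2 * r - 2 : ℤ) / 2 = r - 1 by omega, show x = -3 - (n : ℤ) by omega, h]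
  congr 1
  rw [show (-3 - (n : ℤ) + 1) = -((n + 2 : ℕ) : ℤ) by push_cast; ring, zpow_neg, zpow_natCast]
  simp

lemma corrDiff_neg_two_of_ne {t : ℕ} (ht : 1 ≤ t) (he : Even t) (h2 : t ≠ 2) :
    corrDiff (-2) t = 0 :=
  corrDiff_neg_two he (by obtain ⟨r, hr⟩ := he; omega)

theorem scaledDiff_formula {x : ℤ} {t : ℕ} (ht : 1 ≤ t) (hxt : Even (x + t))
    (hex : ¬ (t = 2 ∧ (x = -2 ∨ x = 0))) :
    scaledDiff x t =
      if x ≤ -3 then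
        (2 : ℝ) ^ (2 * (t : ℤ) + x) *
          (binom (-x - 3) ((x + t) / 2) - binom (-x - 3) ((x + t - 2) / 2))
      else if x ≤ 0 then 0
      else
        -(2 : ℝ) ^ (2 * (t : ℤ) - x - 2) *
          (binom (x - 1) ((t - x - 2) / 2) - binom (x - 1) ((t - x - 4) / 2)) := by
  have hpow : ∀ y : ℤ, (2 : ℝ) ^ (2 * t + 1) * (1 / 4 * (2 : ℝ) ^ (y + 1)) =
      (2 : ℝ) ^ (2 * (t : ℤ) + y) := fun y => by
    have h4 : (1 / 4 : ℝ) = (2 : ℝ) ^ (-2 : ℤ) := by norm_num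
    rw [h4, ← zpow_natCast, ← zpow_add₀ (by norm_num), ← zpow_add₀ (by norm_num)]
    congr 1
    push_cast
    ring
  rw [scaledDiff_eq ht hxt]
  split_ifs with h3 h0
  · rw [corrDiff_of_le_neg_three hxt h3, ← hpow]
    ring
  · have : x = -2 ∨ x = -1 ∨ x = 0 := by omega
    have hev : x ≠ -1 → Even t := fun hx => by
      obtain ⟨r, hr⟩ := hxt
      exact ⟨(t / 2 : ℕ), by omega⟩
    rcases this with rfl | rfl | rfl
    · rw [corrDiff_neg_two_of_ne ht (hev (by norm_num)) (fun h => hex ⟨h, Or.inl rfl⟩)]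
      ring
    · rw [corrDiff_neg_one]; ring
    · have h := corrDiff_reflect 0 t
      norm_num at h
      rw [corrDiff_neg_two_of_ne ht (hev (by norm_num)) (fun h => hex ⟨h, Or.inr rfl⟩)] at h
      rw [show corrDiff 0 t = 0 by linarith]
      ring
  -- Reflection sends `x ≥ 1` to `-x - 2 ≤ -3`, where the closed form is known.
  · have hr := corrDiff_reflect x t
    have he : Even (-x - 2 + (t : ℤ)) := by
      obtain ⟨r, hr⟩ := hxt
      exact ⟨r - x - 1, by omega⟩
    rw [corrDiff_of_le_neg_three he (by omega)] at hr
    rw [show 2 * (t : ℤ) - x - 2 = 2 * (t : ℤ) + (-x - 2) by ring, ← hpow,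
      show corrDiff x t = -(-corrDiff x t) by ring, ← hr,
      show -(-x - 2) - 3 = x - 1 by ring, show -x - 2 + (t : ℤ) = t - x - 2 by ring,
      show (t : ℤ) - x - 2 - 2 = t - x - 4 by ring]
    ring

/-! ### Vanishing outside the light cone and summation of the differences. -/

lemma corrDiff_of_lt {x : ℤ} {t : ℕ} (ht : 1 ≤ t) (hxt : Even (x + t)) (hx : x < -t) :
    corrDiff x t = 0 := by
  rw [corrDiff_of_le_neg_three hxt (by obtain ⟨r, hr⟩ := hxt; omega), binom_of_neg (by omega),
    binom_of_neg (by omega)]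
  ring

/-- All differences left of `-t` vanish, so the correlation equals that at a site so far left that
the evolved spin does not depend on it. -/
lemma corr_spin_of_le {x : ℤ} {t : ℕ} (ht : 1 ≤ t) (hxt : Even (x + t)) (hx : x ≤ -t) :
    corr t (spin x) = 0 := by
  have hshift : ∀ m : ℕ, corr t (spin x) = corr t (spin (x - 2 * m)) := by
    intro m
    induction m with
    | zero => simp
    | succ m ih =>
      have he : Even (x - 2 * ((m + 1 : ℕ) : ℤ) + t) := by
        obtain ⟨r, hr⟩ := hxt
        exact ⟨r - (m + 1), by push_cast; omega⟩
      have h := corrDiff_of_lt ht he (by push_cast; omega)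
      unfold corrDiff at h
      rw [show x - 2 * ((m + 1 : ℕ) : ℤ) + 2 = x - 2 * m by push_cast; ring] at h
      rw [ih]
      linarith
  obtain ⟨N, hN⟩ := isLocal_evolveRec (IsLocal.spin 0) t
  rw [hshift (N + 1)]
  refine expect_spin_mul ⟨N, hN⟩ _ fun s => hN fun i hi => ?_
  have hi' : -(N : ℤ) ≤ i ∧ i ≤ N := abs_le.1 hi
  have : i ≠ x - 2 * ((N + 1 : ℕ) : ℤ) := by push_cast; omega
  exact Function.update_of_ne this _ _

lemma corr_spin_eq_sum {t : ℕ} (ht : 1 ≤ t) (j : ℕ) :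
    corr t (spin (-t + 2 * j)) = ∑ m ∈ Finset.Icc (0 : ℤ) (j - 1), corrDiff (-t + 2 * m) t := by
  induction j with
  | zero => simpa using corr_spin_of_le ht (x := -t) (by simp) le_rfl
  | succ j ih =>
    have hins : Finset.Icc (0 : ℤ) (((j + 1 : ℕ) : ℤ) - 1) =
        insert (j : ℤ) (Finset.Icc (0 : ℤ) (j - 1)) := by
      ext i
      simp only [Finset.mem_Icc, Finset.mem_insert]
      omega
    rw [hins, Finset.sum_insert (by simp), ← ih]
    unfold corrDiff
    rw [show -(t : ℤ) + 2 * ((j + 1 : ℕ) : ℤ) = -t + 2 * j + 2 by push_cast; ring]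
    ring

lemma corr_spin_neg_abs (t : ℕ) (x : ℤ) : corr t (spin (-|x|)) = corr t (spin x) := by
  rcases abs_choice x with h | h <;> rw [h]
  · exact corr_spin_neg t x
  · rw [neg_neg]

theorem corr_spin_eq_sum_abs {x : ℤ} {t : ℕ} (ht : 1 ≤ t) (hxt : Even (x + t)) :
    corr t (spin x) =
      ∑ m ∈ Finset.Icc (0 : ℤ) (((t : ℤ) - |x| - 2) / 2), corrDiff (-t + 2 * m) t := by
  obtain ⟨q, hq⟩ : ∃ q : ℤ, (t : ℤ) - |x| = 2 * q := by
    obtain ⟨r, hr⟩ := hxt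
    rcases abs_choice x with h | h <;> rw [h]
    · exact ⟨r - x, by omega⟩
    · exact ⟨r, by omega⟩
  rw [← corr_spin_neg_abs, show ((t : ℤ) - |x| - 2) / 2 = q - 1 by omega]
  rcases le_or_gt 0 q with h0 | h0
  · obtain ⟨j, rfl⟩ := Int.eq_ofNat_of_zero_le h0
    rw [← corr_spin_eq_sum ht, show -|x| = -(t : ℤ) + 2 * j by omega]
  · rw [Finset.Icc_eq_empty (by omega), Finset.sum_empty]
    exact corr_spin_of_le ht ⟨q, by omega⟩ (by omega)

/-- Pascal's rule rewrites the difference of binomials for sites up to `-3`. At site `-2` the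
convention for `binom` leaves `-1` when `m = 0`, that is `t = 2`, and `0` otherwise, so the sum
formula also covers the exceptional case. -/
lemma corrDiff_light_cone {t : ℕ} (ht : 1 ≤ t) {m : ℤ} (hm : 0 ≤ m) (hmt : -(t : ℤ) + 2 * m ≤ -2) :
    1 / 4 * corrDiff (-t + 2 * m) t = (2 : ℝ) ^ (-(t : ℤ) - 1) *
      ((4 : ℝ) ^ m * (2 * binom ((t : ℤ) - 2 * m - 3) m - binom ((t : ℤ) - 2 * m - 2) m)) := by
  rcases lt_or_eq_of_le hmt with h | h
  · obtain ⟨n, hn⟩ : ∃ n : ℕ, (t : ℤ) - 2 * m - 3 = n := ⟨((t : ℤ) - 2 * m - 3).toNat, by omega⟩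
    rw [corrDiff_of_le_neg_three ⟨m, by ring⟩ (by omega),
      show -(-(t : ℤ) + 2 * m) - 3 = n by omega, show (-(t : ℤ) + 2 * m + t) / 2 = m by omega,
      show (-(t : ℤ) + 2 * m + t - 2) / 2 = m - 1 by omega, hn,
      show (t : ℤ) - 2 * m - 2 = n + 1 by omega, binom_succ]
    have hp : (1 / 4 : ℝ) * 2 ^ (-(t : ℤ) + 2 * m + 1) = 2 ^ (-(t : ℤ) - 1) * 4 ^ m := by
      rw [show (4 : ℝ) ^ m = (2 : ℝ) ^ (2 * m) by rw [zpow_mul]; norm_num,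
        show (1 / 4 : ℝ) = (2 : ℝ) ^ (-2 : ℤ) by norm_num, ← zpow_add₀ (by norm_num),
        ← zpow_add₀ (by norm_num)]
      congr 1
      ring
    rw [← mul_assoc, hp]
    ring
  · have hneg : binom ((t : ℤ) - 2 * m - 3) m = 0 := by
      unfold binom
      rw [if_neg (by omega)]
    rw [hneg, h, show (t : ℤ) - 2 * m - 2 = 0 by omega, binom_zero_left]
    rcases eq_or_ne m 0 with hm0 | hm0
    · subst hm0
      have ht2 : t = 2 := by omega
      subst ht2
      rw [corrDiff_neg_two_two]
      norm_num
    · rw [corrDiff_neg_two ⟨(m + 1).toNat, by omega⟩ (by omega), if_neg hm0]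
      ring

end RCA54

end

theorem mainTheorem4 (x : ℤ) (t : ℕ) (ht : 1 ≤ t) (hxt : Even (x + (t : ℤ))) :
    (¬ (t = 2 ∧ (x = -2 ∨ x = 0)) →
      RCA54.scaledDiff x t =
        if x ≤ -3 then
          (2 : ℝ) ^ (2 * (t : ℤ) + x) *
            (RCA54.binom (-x - 3) ((x + t) / 2) - RCA54.binom (-x - 3) ((x + t - 2) / 2))
        else if x ≤ 0 then 0
        else
          -(2 : ℝ) ^ (2 * (t : ℤ) - x - 2) *
            (RCA54.binom (x - 1) ((t - x - 2) / 2) - RCA54.binom (x - 1) ((t - x - 4) / 2))) ∧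
    RCA54.structureFactor (-(t : ℤ)) t = 0 ∧
    RCA54.structureFactor x t =
      RCA54.structureFactor (-(t : ℤ)) t +
        (2 : ℝ) ^ (-2 * (t : ℤ) - 1) *
          ∑ m ∈ Finset.Icc (0 : ℤ) (((t : ℤ) - |x| - 2) / 2),
            RCA54.scaledDiff (-(t : ℤ) + 2 * m) t ∧
    RCA54.structureFactor x t =
      (2 : ℝ) ^ (-(t : ℤ) - 1) *
        ∑ m ∈ Finset.Icc (0 : ℤ) (((t : ℤ) - |x| - 2) / 2),
          (4 : ℝ) ^ m *
            (2 * RCA54.binom ((t : ℤ) - 2 * m - 3) m - RCA54.binom ((t : ℤ) - 2 * m - 2) m) ∧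
    RCA54.structureFactorRec x t = RCA54.structureFactor x t := by
  have h0 : RCA54.structureFactor (-(t : ℤ)) t = 0 := by
    rw [RCA54.structureFactor_eq ht (by simp), RCA54.corr_spin_of_le ht (by simp) le_rfl, mul_zero]
  have hs := RCA54.structureFactor_eq ht hxt
  refine ⟨RCA54.scaledDiff_formula ht hxt, h0, ?_, ?_, ?_⟩
  · rw [h0, zero_add, hs, RCA54.corr_spin_eq_sum_abs ht hxt, Finset.mul_sum, Finset.mul_sum]
    refine Finset.sum_congr rfl fun m _ => ?_
    rw [RCA54.scaledDiff_eq ht ⟨m, by ring⟩, ← mul_assoc, ← zpow_natCast,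
      ← zpow_add₀ (by norm_num)]
    rw [show -2 * (t : ℤ) - 1 + ((2 * t + 1 : ℕ) : ℤ) = 0 by push_cast; ring, zpow_zero, one_mul]
  · rw [hs, RCA54.corr_spin_eq_sum_abs ht hxt, Finset.mul_sum, Finset.mul_sum]
    refine Finset.sum_congr rfl fun m hm => ?_
    obtain ⟨hm0, hm1⟩ := Finset.mem_Icc.1 hm
    exact RCA54.corrDiff_light_cone ht hm0 (by have := abs_nonneg x; omega)
  · rw [RCA54.structureFactorRec_eq, hs]
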